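/- For a unitary matrix $X\in U(2)$ let $\Lambda_X(s)=\det(I-sX^{\dagger})$, where $X^\dagger$ is the conjugate transpose of $X$, let $\Lambda_X'$ be its derivative in $s$, and let $dX$ be Haar measure on $U(2)$ normalized to be a probability measure. Let ${}_3F_2(a_1,a_2,a_3;b_1,b_2;z)=\sum_{n=0}^\infty \frac{(a_1)_n(a_2)_n(a_3)_n}{(b_1)_n(b_2)_n}\frac{z^n}{n!}$, where $(a)_0=1$ and $(a)_n=a(a+1)\cdots(a+n-1)$ for $n\ge 1$. Let $k,x\in\mathbb{C}$. If $|x|>1$, or if $|x|=1$ and $\Re k>-1$, then $|\Lambda_X'(x)|^{2k}$ is integrable on $U(2)$, the series below converges absolutely, and $$\int_{U(2)}|\Lambda_X'(x)|^{2k}\,dX=2^{2k}|x|^{2k}\,{}_3F_2\!\left(\tfrac12,-k,-k;1,2;|x|^{-2}\right).$$ Moreover, when $\Re k>-1$, the integral on the left-hand side is a continuous function of $x$ on $\{x\in\mathbb{C}:|x|\ge 1\}$, so that the formula on $|x|=1$ is the extension by continuity of the formula on $|x|>1$. -/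

import Mathlib

open MeasureTheory

noncomputable section

namespace UnitaryMoments

/-- The unitary group `U(N)` of complex `N × N` matrices. -/
abbrev U (N : ℕ) : Type := Matrix.unitaryGroup (Fin N) ℂ

/-- `U(N)` is compact: it is closed, and the entries of a unitary matrix are bounded by `1`. -/
instance instCompactSpaceU (N : ℕ) : CompactSpace (U N) := by
  have hclosed : IsClosed (Matrix.unitaryGroup (Fin N) ℂ : Set (Matrix (Fin N) (Fin N) ℂ)) :=
    isClosed_unitary
  have hK : IsCompact ((Set.univ : Set (Fin N)).pi fun _ =>
      (Set.univ : Set (Fin N)).pi fun _ => Metric.closedBall (0 : ℂ) 1) :=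
    isCompact_univ_pi fun _ => isCompact_univ_pi fun _ => isCompact_closedBall 0 1
  refine isCompact_iff_compactSpace.mp (hK.of_isClosed_subset hclosed ?_)
  intro A hA i _ j _
  simpa using entry_norm_bound_of_unitary hA i j

/-- `U(N)` carries its Borel sigma-algebra. -/
instance instMeasurableSpaceU (N : ℕ) : MeasurableSpace (U N) := borel (U N)

instance instBorelSpaceU (N : ℕ) : BorelSpace (U N) := ⟨rfl⟩

/-- Haar measure `dX` on `U(N)`, normalized to have total mass `1`. -/
def haarU (N : ℕ) : Measure (U N) := Measure.haarMeasure ⊤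

instance instIsHaarMeasureHaarU (N : ℕ) : (haarU N).IsHaarMeasure :=
  Measure.isHaarMeasure_haarMeasure ⊤

instance instIsProbabilityMeasureHaarU (N : ℕ) : IsProbabilityMeasure (haarU N) :=
  ⟨by simpa [haarU] using Measure.haarMeasure_self (K₀ := (⊤ : TopologicalSpace.PositiveCompacts (U N)))⟩

/-- The characteristic polynomial `Λ_X(s) = det (I - s X†)` of `X ∈ U(N)`. -/
def charPoly {N : ℕ} (X : U N) (s : ℂ) : ℂ :=
  (1 - s • (X : Matrix (Fin N) (Fin N) ℂ).conjTranspose).det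

/-- The integrand `|Λ_X'(x)|^{2k}`, for complex `k`. -/
def derivPow {N : ℕ} (k x : ℂ) (X : U N) : ℂ :=
  ((‖deriv (charPoly X) x‖ : ℝ) : ℂ) ^ (2 * k)

/-- The `n`-th term of the hypergeometric series `₃F₂(a₁, a₂, a₃; b₁, b₂; z)`;
`(ascPochhammer ℂ n).eval a` is the rising factorial `(a)_n = a (a + 1) ⋯ (a + n - 1)`. -/
def hyp32Term (a₁ a₂ a₃ b₁ b₂ z : ℂ) (n : ℕ) : ℂ :=
  (ascPochhammer ℂ n).eval a₁ * (ascPochhammer ℂ n).eval a₂ * (ascPochhammer ℂ n).eval a₃ /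
    ((ascPochhammer ℂ n).eval b₁ * (ascPochhammer ℂ n).eval b₂) * (z ^ n / (n.factorial : ℂ))

/-- The hypergeometric series `₃F₂(a₁, a₂, a₃; b₁, b₂; z)`. -/
def hyp32 (a₁ a₂ a₃ b₁ b₂ z : ℂ) : ℂ := ∑' n : ℕ, hyp32Term a₁ a₂ a₃ b₁ b₂ z n

end UnitaryMoments

end

namespace UnitaryMoments

open ComplexConjugate Filter Topology

/-! For `X ∈ U(2)` with `a = X 0 0`, unitarity gives `tr X = a + det X · conj a`, hence `|Λ_X'(x)| =
|2x - tr X|`. If `|x| > 1`, then `t = tr X / (2x)` satisfies `|t| ≤ 1/|x| < 1`, so `|1 - t|^{2k} =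
(1 - t)^k (1 - conj t)^k` is an absolutely convergent double binomial series that may be integrated
termwise. Invariance under scalars kills the off-diagonal terms, and the diagonal ones are the
Catalan moments `∫ |tr X|^{2n} = C(2n,n)/(n+1)` (`integral_norm_trace_pow`), which follow from `∫
|a|^{2n} = 1/(n+1)`. This gives the `₃F₂` (`hasSum_hyp32Term`).

On `|x| = 1` with `Re k > -1`, the coefficients `(-k)_n / n!` are bounded and the Catalan numbers
over `4^n` are summable, so the series converges uniformly on the closed disc. For real exponents in
`(-1, 0]` this bounds the integrals uniformly as `x ↓ 1`; Fatou's lemma gives integrability at `x =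
1`, and dominated convergence gives continuity and the boundary formula. -/

/-! ### Reduction of the derivative to the trace -/

lemma adjugate_eq_det_smul_conjTranspose {N : ℕ} (X : U N) :
    (X : Matrix (Fin N) (Fin N) ℂ).adjugate =
      (X : Matrix (Fin N) (Fin N) ℂ).det • (X : Matrix (Fin N) (Fin N) ℂ).conjTranspose := by
  have h : (X : Matrix (Fin N) (Fin N) ℂ) * (X : Matrix (Fin N) (Fin N) ℂ).conjTranspose = 1 :=
    Matrix.mem_unitaryGroup_iff.1 X.2
  calc (X : Matrix (Fin N) (Fin N) ℂ).adjugate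
      = (X : Matrix (Fin N) (Fin N) ℂ).adjugate * (X *
          (X : Matrix (Fin N) (Fin N) ℂ).conjTranspose) := by rw [h, mul_one]
    _ = _ := by rw [← mul_assoc, Matrix.adjugate_mul, Matrix.smul_mul, one_mul]

lemma norm_det_eq_one {N : ℕ} (X : U N) : ‖(X : Matrix (Fin N) (Fin N) ℂ).det‖ = 1 :=
  CStarRing.norm_of_mem_unitary (Matrix.det_of_mem_unitary X.2)

lemma entry_one_one (X : U 2) : X.1 1 1 = X.1.det * conj (X.1 0 0) := by
  have h := congrFun (congrFun (adjugate_eq_det_smul_conjTranspose X) 0) 0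
  simpa [Matrix.adjugate_fin_two] using h

lemma trace_eq (X : U 2) : X.1.trace = X.1 0 0 + X.1.det * conj (X.1 0 0) := by
  rw [Matrix.trace_fin_two, entry_one_one]

lemma norm_sq_column (X : U 2) : ‖X.1 0 0‖ ^ 2 + ‖X.1 1 0‖ ^ 2 = 1 := by
  have h : star X.1 * X.1 = 1 := Matrix.mem_unitaryGroup_iff'.1 X.2
  have h0 := congrFun (congrFun h 0) 0
  simp only [Matrix.mul_apply, Fin.sum_univ_two, Matrix.star_apply, Matrix.one_apply_eq,
    RCLike.star_def, Complex.conj_mul'] at h0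
  exact_mod_cast h0

lemma norm_trace_le (X : U 2) : ‖X.1.trace‖ ≤ 2 := by
  have h0 := entry_norm_bound_of_unitary X.2 0 0
  have h1 := entry_norm_bound_of_unitary X.2 1 1
  rw [Matrix.trace_fin_two]
  linarith [norm_add_le (X.1 0 0) (X.1 1 1)]

lemma deriv_charPoly (X : U 2) (x : ℂ) :
    deriv (charPoly X) x = 2 * x * conj X.1.det - conj X.1.trace := by
  have h : charPoly X = fun s => 1 - s * conj X.1.trace + s ^ 2 * conj X.1.det := by
    funext s
    simp [charPoly, Matrix.det_fin_two, Matrix.trace_fin_two]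
    ring
  have h1 : HasDerivAt (charPoly X) (0 - 1 * conj X.1.trace + (2 : ℕ) * x ^ (2 - 1) * conj X.1.det) x := by
    rw [h]
    exact (((hasDerivAt_const x (1 : ℂ)).sub ((hasDerivAt_id x).mul_const _))).add
      ((hasDerivAt_pow 2 x).mul_const _)
  rw [h1.deriv]
  push_cast
  ring

lemma norm_deriv_charPoly (X : U 2) (x : ℂ) :
    ‖deriv (charPoly X) x‖ = ‖2 * x - X.1.trace‖ := by
  have hd : X.1.det * conj X.1.det = 1 := by
    rw [Complex.mul_conj', norm_det_eq_one]; simp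
  have h : X.1.det * deriv (charPoly X) x = 2 * x - X.1.trace := by
    rw [deriv_charPoly, trace_eq]
    simp only [map_add, map_mul, Complex.conj_conj]
    linear_combination (2 * x - X.1 0 0) * hd
  rw [← h, norm_mul, norm_det_eq_one, one_mul]

/-! ### Haar invariance and orthogonality of monomials -/

/-- The diagonal unitary matrix `diag(u, v)`. -/
noncomputable def diagU (u v : ℂ) (hu : ‖u‖ = 1) (hv : ‖v‖ = 1) : U 2 :=
  ⟨!![u, 0; 0, v], by
    rw [Matrix.mem_unitaryGroup_iff]
    ext i j
    fin_cases i <;> fin_cases j <;> simp [Matrix.mul_apply, Complex.mul_conj', hu, hv]⟩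

lemma diagU_mul_apply_zero (u v : ℂ) (hu : ‖u‖ = 1) (hv : ‖v‖ = 1) (X : U 2) (j : Fin 2) :
    (diagU u v hu hv * X).1 0 j = u * X.1 0 j := by
  rw [Submonoid.coe_mul, Matrix.mul_apply]
  simp [diagU]

lemma diagU_mul_apply_one (u v : ℂ) (hu : ‖u‖ = 1) (hv : ‖v‖ = 1) (X : U 2) (j : Fin 2) :
    (diagU u v hu hv * X).1 1 j = v * X.1 1 j := by
  rw [Submonoid.coe_mul, Matrix.mul_apply]
  simp [diagU]

lemma det_diagU_mul (u v : ℂ) (hu : ‖u‖ = 1) (hv : ‖v‖ = 1) (X : U 2) :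
    (diagU u v hu hv * X).1.det = u * v * X.1.det := by
  rw [Submonoid.coe_mul, Matrix.det_mul]
  simp [diagU]

/-- The rotation matrix proportional to `!![1, y; -y, 1]`. -/
noncomputable def rotU (y : ℝ) : U 2 :=
  ⟨((√(1 + y ^ 2))⁻¹ : ℂ) • !![1, (y : ℂ); -(y : ℂ), 1], by
    have h : ((√(1 + y ^ 2) : ℝ) : ℂ) * ((√(1 + y ^ 2) : ℝ) : ℂ) = 1 + y ^ 2 := by
      rw [← Complex.ofReal_mul, Real.mul_self_sqrt (by positivity)]; push_cast; ring
    have h0 : ((√(1 + y ^ 2) : ℝ) : ℂ) ≠ 0 := by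
      simpa using (Real.sqrt_pos.2 (by positivity : 0 < 1 + y ^ 2)).ne'
    rw [Matrix.mem_unitaryGroup_iff]
    ext i j
    fin_cases i <;> fin_cases j <;> simp [Matrix.mul_apply] <;> field_simp <;>
      first | ring1 | linear_combination -h⟩

lemma integral_eq_zero_of_mul_left {N : ℕ} {f : U N → ℂ} (g : U N) {w : ℂ} (hw : w ≠ 1)
    (h : ∀ X, f (g * X) = w * f X) : ∫ X, f X ∂(haarU N) = 0 := by
  have h1 := integral_mul_left_eq_self (μ := haarU N) f g
  simp only [h, integral_const_mul] at h1
  have h2 : (w - 1) * ∫ X, f X ∂(haarU N) = 0 := by rw [sub_mul, h1]; ring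
  exact (mul_eq_zero.1 h2).resolve_left (sub_ne_zero.2 hw)

/-- Otherwise `i - j` would be a multiple of `2π`, making `π` rational. Thus the single phase `e^I`
separates all exponents at once. -/
lemma exp_I_pow_ne {i j : ℕ} (hij : i ≠ j) :
    Complex.exp Complex.I ^ i * conj (Complex.exp Complex.I ^ j) ≠ 1 := by
  rw [map_pow, ← Complex.exp_conj, Complex.conj_I, ← Complex.exp_nat_mul, ← Complex.exp_nat_mul,
    ← Complex.exp_add, Ne, Complex.exp_eq_one_iff]
  rintro ⟨n, hn⟩
  have h : ((i : ℝ) - j) = n * (2 * Real.pi) := by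
    have := congrArg Complex.im hn
    simpa [sub_eq_add_neg] using this
  have hn0 : n ≠ 0 := by
    rintro rfl
    apply hij
    have : (i : ℝ) = j := by simpa [sub_eq_zero] using h
    exact_mod_cast this
  refine irrational_pi ⟨((i : ℚ) - j) / (2 * n), ?_⟩
  push_cast
  rw [h]
  have : (n : ℝ) ≠ 0 := by exact_mod_cast hn0
  field_simp

lemma norm_exp_I : ‖Complex.exp Complex.I‖ = 1 := by
  simpa using Complex.norm_exp_ofReal_mul_I 1

lemma continuous_integrable {N : ℕ} {E : Type*} [NormedAddCommGroup E] {f : U N → E}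
    (hf : Continuous f) : Integrable f (haarU N) :=
  hf.integrable_of_hasCompactSupport (HasCompactSupport.of_compactSpace f)

@[fun_prop]
lemma continuous_entry {N : ℕ} (i j : Fin N) : Continuous fun X : U N => X.1 i j :=
  continuous_subtype_val.matrix_elem i j

@[fun_prop]
lemma continuous_detU {N : ℕ} : Continuous fun X : U N => X.1.det :=
  continuous_subtype_val.matrix_det

@[fun_prop]
lemma continuous_traceU {N : ℕ} : Continuous fun X : U N => X.1.trace :=
  continuous_subtype_val.matrix_trace

lemma integral_trace_pow_of_ne {m n : ℕ} (hmn : m ≠ n) :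
    ∫ X : U 2, X.1.trace ^ m * conj (X.1.trace ^ n) ∂(haarU 2) = 0 := by
  refine integral_eq_zero_of_mul_left (diagU _ _ norm_exp_I norm_exp_I) (exp_I_pow_ne hmn) ?_
  intro X
  have : ((diagU _ _ norm_exp_I norm_exp_I) * X).1.trace = Complex.exp Complex.I * X.1.trace := by
    rw [Matrix.trace_fin_two, Matrix.trace_fin_two, diagU_mul_apply_zero, diagU_mul_apply_one,
      mul_add]
  rw [this, mul_pow, mul_pow, map_mul]
  ring

lemma integral_column_monomial_of_ne {p q i j : ℕ} (hij : i ≠ j) :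
    ∫ X : U 2, X.1 0 0 ^ p * X.1 1 0 ^ i * conj (X.1 0 0 ^ q * X.1 1 0 ^ j) ∂(haarU 2) = 0 := by
  refine integral_eq_zero_of_mul_left (diagU 1 _ norm_one norm_exp_I) (exp_I_pow_ne hij) ?_
  intro X
  simp only [diagU_mul_apply_zero, diagU_mul_apply_one, one_mul, mul_pow, map_mul]
  ring

lemma integral_det_monomial_of_ne {p q i j : ℕ} (hij : i ≠ j) :
    ∫ X : U 2, X.1 0 0 ^ p * X.1.det ^ i * conj (X.1 0 0 ^ q * X.1.det ^ j) ∂(haarU 2) = 0 := by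
  refine integral_eq_zero_of_mul_left (diagU 1 _ norm_one norm_exp_I) (exp_I_pow_ne hij) ?_
  intro X
  simp only [diagU_mul_apply_zero, det_diagU_mul, one_mul, mul_pow, map_mul]
  ring


lemma rotU_mul_apply_zero (y : ℝ) (X : U 2) :
    (rotU y * X).1 0 0 = ((√(1 + y ^ 2))⁻¹ : ℂ) * (X.1 0 0 + y * X.1 1 0) := by
  rw [Submonoid.coe_mul, Matrix.mul_apply]
  simp [rotU]
  ring

/-! ### Moments of an entry and of the trace -/

lemma integral_norm_sq_sum {N : ℕ} (s : Finset ℕ) (p : ℕ → U N → ℂ) (hc : ∀ i, Continuous (p i))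
    (h : ∀ i j, i ≠ j → ∫ X, p i X * conj (p j X) ∂(haarU N) = 0) :
    ∫ X, ‖∑ i ∈ s, p i X‖ ^ 2 ∂(haarU N) = ∑ i ∈ s, ∫ X, ‖p i X‖ ^ 2 ∂(haarU N) := by
  have hint : ∀ i j, Integrable (fun X => p i X * conj (p j X)) (haarU N) := fun i j =>
    continuous_integrable ((hc i).mul (Complex.continuous_conj.comp (hc j)))
  have key : ∫ X, (∑ i ∈ s, p i X) * conj (∑ i ∈ s, p i X) ∂(haarU N) =
      ∑ i ∈ s, ∫ X, p i X * conj (p i X) ∂(haarU N) := by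
    simp only [map_sum, Finset.sum_mul_sum]
    rw [integral_finsetSum _ fun i _ => integrable_finsetSum _ fun j _ => hint i j]
    refine Finset.sum_congr rfl fun i hi => ?_
    rw [integral_finsetSum _ fun j _ => hint i j]
    exact Finset.sum_eq_single_of_mem i hi fun j _ hj => h i j hj.symm
  simp only [Complex.mul_conj', ← Complex.ofReal_pow, integral_complex_ofReal] at key
  exact_mod_cast key

lemma integral_norm_add_mul_pow (n : ℕ) (y : ℝ) :
    ∫ X : U 2, ‖X.1 0 0 + y * X.1 1 0‖ ^ (2 * n) ∂(haarU 2) =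
      ∑ i ∈ Finset.range (n + 1), (n.choose i : ℝ) ^ 2 *
        (∫ X : U 2, ‖X.1 0 0‖ ^ (2 * (n - i)) * ‖X.1 1 0‖ ^ (2 * i) ∂(haarU 2)) * (y ^ 2) ^ i := by
  have h := integral_norm_sq_sum (Finset.range (n + 1))
    (fun i (X : U 2) => (((y : ℂ) ^ i * n.choose i)) * (X.1 0 0 ^ (n - i) * X.1 1 0 ^ i))
    (fun i => by fun_prop) (fun i j hij => by
      have h0 := integral_column_monomial_of_ne (p := n - i) (q := n - j) hij
      have h1 : ∀ X : U 2, ((y : ℂ) ^ i * n.choose i) * (X.1 0 0 ^ (n - i) * X.1 1 0 ^ i) *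
          conj (((y : ℂ) ^ j * n.choose j) * (X.1 0 0 ^ (n - j) * X.1 1 0 ^ j)) =
          (((y : ℂ) ^ i * n.choose i) * conj ((y : ℂ) ^ j * n.choose j)) *
          (X.1 0 0 ^ (n - i) * X.1 1 0 ^ i * conj (X.1 0 0 ^ (n - j) * X.1 1 0 ^ j)) := by
        intro X; simp only [map_mul]; ring
      simp only [h1, integral_const_mul, h0, mul_zero])
  have h2 : ∀ X : U 2, ‖X.1 0 0 + y * X.1 1 0‖ ^ (2 * n) = ‖∑ i ∈ Finset.range (n + 1),
      ((y : ℂ) ^ i * n.choose i) * (X.1 0 0 ^ (n - i) * X.1 1 0 ^ i)‖ ^ 2 := by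
    intro X
    rw [mul_comm 2 n, pow_mul, ← norm_pow, add_comm, add_pow]
    congr 2
    refine Finset.sum_congr rfl fun i _ => ?_
    rw [mul_pow]; ring
  simp only [h2, h]
  refine Finset.sum_congr rfl fun i _ => ?_
  have h3 : ∀ X : U 2, ‖((y : ℂ) ^ i * n.choose i) * (X.1 0 0 ^ (n - i) * X.1 1 0 ^ i)‖ ^ 2 =
      (n.choose i : ℝ) ^ 2 * (y ^ 2) ^ i * (‖X.1 0 0‖ ^ (2 * (n - i)) * ‖X.1 1 0‖ ^ (2 * i)) := by
    intro X
    simp only [norm_mul, norm_pow, Complex.norm_natCast, Complex.norm_real, Real.norm_eq_abs]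
    rw [← sq_abs y]
    ring
  simp only [h3, integral_const_mul]
  ring

lemma integral_norm_add_mul_pow_eq (n : ℕ) (y : ℝ) :
    ∫ X : U 2, ‖X.1 0 0 + y * X.1 1 0‖ ^ (2 * n) ∂(haarU 2) =
      (1 + y ^ 2) ^ n * ∫ X : U 2, ‖X.1 0 0‖ ^ (2 * n) ∂(haarU 2) := by
  have hp : 0 < 1 + y ^ 2 := by positivity
  rw [← integral_mul_left_eq_self (fun X : U 2 => ‖X.1 0 0‖ ^ (2 * n)) (rotU y),
    ← integral_const_mul]
  congr 1
  funext X
  rw [rotU_mul_apply_zero, norm_mul, mul_pow, norm_inv, Complex.norm_real,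
    Real.norm_of_nonneg (Real.sqrt_nonneg _), pow_mul _ 2 n, pow_mul, inv_pow, Real.sq_sqrt hp.le,
    inv_pow, mul_inv_cancel_left₀ (pow_ne_zero _ hp.ne')]

/-- Orthogonality and rotation invariance evaluate the same integral of `|a + y b|^{2n}`, where `(a,
b)` is the first column, as two polynomials in `y²`; their coefficients are compared. -/
lemma choose_mul_column_moment (n i : ℕ) (hi : i ≤ n) :
    (n.choose i : ℝ) *
      ∫ X : U 2, ‖X.1 0 0‖ ^ (2 * (n - i)) * ‖X.1 1 0‖ ^ (2 * i) ∂(haarU 2) =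
      ∫ X : U 2, ‖X.1 0 0‖ ^ (2 * n) ∂(haarU 2) := by
  set M := ∫ X : U 2, ‖X.1 0 0‖ ^ (2 * n) ∂(haarU 2)
  set m : ℕ → ℝ := fun i => ∫ X : U 2, ‖X.1 0 0‖ ^ (2 * (n - i)) * ‖X.1 1 0‖ ^ (2 * i) ∂(haarU 2)
    with hm
  have hpoly : (∑ i ∈ Finset.range (n + 1),
      Polynomial.monomial i ((n.choose i : ℝ) ^ 2 * m i) : Polynomial ℝ) =
      Polynomial.C M * (1 + Polynomial.X) ^ n := by
    -- The variable `t` stands for `y²`, so agreement is available at every `t ≥ 0`.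
    refine Polynomial.eq_of_infinite_eval_eq _ _ ((Set.Ici_infinite (0 : ℝ)).mono fun t ht => ?_)
    have h1 := integral_norm_add_mul_pow n (√t)
    rw [integral_norm_add_mul_pow_eq, Real.sq_sqrt ht] at h1
    simp only [Set.mem_ofPred_eq, Polynomial.eval_finsetSum, Polynomial.eval_monomial,
      Polynomial.eval_mul, Polynomial.eval_C, Polynomial.eval_pow, Polynomial.eval_add,
      Polynomial.eval_one, Polynomial.eval_X]
    rw [← h1, mul_comm]
  have hcoeff := congrArg (fun p => Polynomial.coeff p i) hpoly
  simp only [Polynomial.finsetSum_coeff, Polynomial.coeff_monomial, Polynomial.coeff_C_mul,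
    Polynomial.coeff_one_add_X_pow, Finset.sum_ite_eq', Finset.mem_range,
    Nat.lt_succ_of_le hi, if_true] at hcoeff
  have hc : (n.choose i : ℝ) ≠ 0 := by exact_mod_cast (Nat.choose_pos hi).ne'
  refine mul_left_cancel₀ hc ?_
  rw [← mul_assoc, ← sq, hcoeff, mul_comm]

/-- Integrating `(|a|² + |b|²)^n = 1` yields `n + 1` binomial terms, each equal to the moment
sought. -/
lemma integral_norm_entry_pow (n : ℕ) :
    ∫ X : U 2, ‖X.1 0 0‖ ^ (2 * n) ∂(haarU 2) = 1 / (n + 1) := by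
  have h1 : ∀ X : U 2, (1 : ℝ) = ∑ i ∈ Finset.range (n + 1),
      (n.choose i : ℝ) * (‖X.1 0 0‖ ^ (2 * (n - i)) * ‖X.1 1 0‖ ^ (2 * i)) := by
    intro X
    rw [← one_pow n, ← norm_sq_column X, add_comm, add_pow]
    refine Finset.sum_congr rfl fun i _ => ?_
    rw [pow_mul, pow_mul]; ring
  have h2 : (1 : ℝ) = ∑ i ∈ Finset.range (n + 1),
      ∫ X : U 2, ‖X.1 0 0‖ ^ (2 * n) ∂(haarU 2) := by
    calc (1 : ℝ) = ∫ _ : U 2, (1 : ℝ) ∂(haarU 2) := by simp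
      _ = ∫ X : U 2, ∑ i ∈ Finset.range (n + 1),
          (n.choose i : ℝ) * (‖X.1 0 0‖ ^ (2 * (n - i)) * ‖X.1 1 0‖ ^ (2 * i)) ∂(haarU 2) :=
        integral_congr_ae (.of_forall h1)
      _ = _ := by
        rw [integral_finsetSum _ fun i _ => continuous_integrable (by fun_prop)]
        refine Finset.sum_congr rfl fun i hi => ?_
        rw [integral_const_mul, choose_mul_column_moment n i (Finset.mem_range_succ_iff.1 hi)]
  rw [Finset.sum_const, Finset.card_range, nsmul_eq_mul] at h2
  have : (n : ℝ) + 1 ≠ 0 := by positivity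
  push_cast at h2
  field_simp
  linarith

/-- The binomial terms of `(a + det X · conj a)^n` carry different powers of `det X`, hence are
orthogonal. Each has modulus `C(n,i) |a|^n`, and `∑ C(n,i)² = C(2n,n)`. -/
lemma integral_norm_trace_pow (n : ℕ) :
    ∫ X : U 2, ‖X.1.trace‖ ^ (2 * n) ∂(haarU 2) = n.centralBinom / (n + 1) := by
  have h := integral_norm_sq_sum (Finset.range (n + 1))
    (fun i (X : U 2) => (n.choose i : ℂ) * (X.1 0 0 ^ (n - i) * (X.1.det * conj (X.1 0 0)) ^ i))
    (fun i => by fun_prop) (fun i j hij => by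
      -- The powers of `conj a` in each factor are moved to the other side of the conjugation, which
      -- shifts the exponents by `j` and `i`.
      have h0 := integral_det_monomial_of_ne (p := n - i + j) (q := n - j + i) hij
      have h1 : ∀ X : U 2, (n.choose i : ℂ) * (X.1 0 0 ^ (n - i) * (X.1.det * conj (X.1 0 0)) ^ i) *
          conj ((n.choose j : ℂ) * (X.1 0 0 ^ (n - j) * (X.1.det * conj (X.1 0 0)) ^ j)) =
          ((n.choose i : ℂ) * n.choose j) *
          (X.1 0 0 ^ (n - i + j) * X.1.det ^ i * conj (X.1 0 0 ^ (n - j + i) * X.1.det ^ j)) := by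
        intro X
        simp only [map_mul, map_pow, Complex.conj_conj, map_natCast, pow_add, mul_pow]
        ring
      simp only [h1, integral_const_mul, h0, mul_zero])
  have h2 : ∀ X : U 2, ‖X.1.trace‖ ^ (2 * n) = ‖∑ i ∈ Finset.range (n + 1),
      (n.choose i : ℂ) * (X.1 0 0 ^ (n - i) * (X.1.det * conj (X.1 0 0)) ^ i)‖ ^ 2 := by
    intro X
    rw [trace_eq, mul_comm 2 n, pow_mul, ← norm_pow, add_comm, add_pow]
    congr 2
    refine Finset.sum_congr rfl fun i _ => ?_
    ring
  simp only [h2, h]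
  have h3 : ∀ i ∈ Finset.range (n + 1), ∫ X : U 2, ‖(n.choose i : ℂ) *
      (X.1 0 0 ^ (n - i) * (X.1.det * conj (X.1 0 0)) ^ i)‖ ^ 2 ∂(haarU 2) =
      (n.choose i : ℝ) ^ 2 * (1 / (n + 1)) := by
    intro i hi
    rw [← integral_norm_entry_pow, ← integral_const_mul]
    congr 1
    funext X
    have hin : n - i + i = n := Nat.sub_add_cancel (Finset.mem_range_succ_iff.1 hi)
    simp only [norm_mul, norm_pow, Complex.norm_natCast, norm_det_eq_one, one_mul,
      RCLike.norm_conj, ← pow_add, hin]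
    rw [mul_pow, ← pow_mul, mul_comm n 2]
  rw [Finset.sum_congr rfl h3, ← Finset.sum_mul, Nat.centralBinom_eq_two_mul_choose,
    ← Nat.sum_range_choose_sq]
  push_cast
  ring

lemma integral_trace_pow_mul_conj (m n : ℕ) :
    ∫ X : U 2, X.1.trace ^ m * conj (X.1.trace ^ n) ∂(haarU 2) =
      if m = n then (n.centralBinom / (n + 1) : ℂ) else 0 := by
  split_ifs with h
  · subst h
    have h1 : ∀ X : U 2, X.1.trace ^ m * conj (X.1.trace ^ m) =
        ((‖X.1.trace‖ ^ (2 * m) : ℝ) : ℂ) := by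
      intro X
      rw [Complex.mul_conj', norm_pow, mul_comm 2 m, pow_mul, Complex.ofReal_pow (_ ^ m)]
    simp only [h1, integral_complex_ofReal, integral_norm_trace_pow]
    push_cast
    rfl
  · exact integral_trace_pow_of_ne h

/-! ### Binomial and hypergeometric coefficients -/

/-- The coefficient `(-k)_n / n!` of `t ^ n` in the Taylor expansion of `(1 - t) ^ k`. -/
noncomputable def binomCoeff (k : ℂ) (n : ℕ) : ℂ :=
  (ascPochhammer ℂ n).eval (-k) / n.factorial

/-- The `2n`-th moment of `|tr X| / 2` on `U(2)`. -/
noncomputable def halfTraceMoment (n : ℕ) : ℝ := n.centralBinom / ((n + 1) * 4 ^ n)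

lemma ring_choose_eq (k : ℂ) (n : ℕ) : Ring.choose k n = (-1) ^ n * binomCoeff k n := by
  rw [binomCoeff, Ring.choose_eq_smul, Polynomial.descPochhammer_smeval_eq_ascPochhammer,
    Polynomial.ascPochhammer_smeval_cast, Polynomial.ascPochhammer_smeval_eq_eval,
    ascPochhammer_eval_neg_eq_descPochhammer, descPochhammer_eval_eq_ascPochhammer, smul_eq_mul]
  have h : ((-1 : ℂ) ^ n) * (-1) ^ n = 1 := by rw [← mul_pow]; simp
  linear_combination (-(n.factorial : ℂ)⁻¹ * (ascPochhammer ℂ n).eval (k - n + 1)) * h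

lemma hasSum_one_sub_cpow (k : ℂ) {t : ℂ} (ht : ‖t‖ < 1) :
    HasSum (fun n => binomCoeff k n * t ^ n) ((1 - t) ^ k) := by
  have h := (Complex.one_add_cpow_hasFPowerSeriesOnBall_zero (a := k)).hasSum (y := -t) (by
    rw [← ENNReal.ofReal_one, Metric.eball_ofReal]; simpa using ht)
  simp only [binomialSeries_apply, List.ofFn_const, List.prod_replicate, smul_eq_mul,
    ring_choose_eq] at h
  have hterm : ∀ n, (-1) ^ n * binomCoeff k n * (-t) ^ n = binomCoeff k n * t ^ n := fun n => by
    have h1 : ((-1 : ℂ) ^ n) * (-1) ^ n = 1 := by rw [← mul_pow]; simp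
    rw [neg_pow]
    linear_combination (binomCoeff k n * t ^ n) * h1
  simp only [hterm] at h
  rwa [zero_add, ← sub_eq_add_neg] at h

/-- Since `1 - t` avoids the branch cut, the principal logarithm commutes with conjugation, and the
two logarithms add up to `2 log |1 - t|`. -/
lemma one_sub_cpow_mul_conj (k : ℂ) {t : ℂ} (ht : ‖t‖ < 1) :
    (1 - t) ^ k * (1 - conj t) ^ k = ((‖1 - t‖ : ℝ) : ℂ) ^ (2 * k) := by
  have hs : 1 - t ∈ Complex.slitPlane := by
    simpa [sub_eq_add_neg] using Complex.mem_slitPlane_of_norm_lt_one (z := -t) (by simpa using ht)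
  have h0 : 1 - t ≠ 0 := Complex.slitPlane_ne_zero hs
  have hc : 1 - conj t = conj (1 - t) := by simp
  have hc0 : conj (1 - t) ≠ 0 := (map_ne_zero _).2 h0
  have hn0 : ((‖1 - t‖ : ℝ) : ℂ) ≠ 0 := by simpa using h0
  rw [hc, Complex.cpow_def_of_ne_zero h0, Complex.cpow_def_of_ne_zero hc0,
    Complex.cpow_def_of_ne_zero hn0, ← Complex.exp_add, Complex.log_conj _
      (Complex.slitPlane_arg_ne_pi hs), ← Complex.ofReal_log (norm_nonneg _), ← add_mul,
    Complex.add_conj, Complex.log_re]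
  congr 1
  push_cast
  ring

lemma ascPochhammer_eval_two (n : ℕ) : (ascPochhammer ℂ n).eval 2 = (n + 1).factorial := by
  induction n with
  | zero => simp
  | succ n ih =>
    rw [ascPochhammer_succ_eval, ih, Nat.factorial_succ (n + 1)]; push_cast; ring

lemma ascPochhammer_eval_half (n : ℕ) :
    (ascPochhammer ℂ n).eval (1 / 2) * 4 ^ n = n.centralBinom * n.factorial := by
  induction n with
  | zero => simp
  | succ n ih =>
    have h : ((n : ℂ) + 1) * (n + 1).centralBinom = 2 * (2 * n + 1) * n.centralBinom := by
      exact_mod_cast Nat.succ_mul_centralBinom_succ n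
    rw [ascPochhammer_succ_eval, Nat.factorial_succ, pow_succ]
    push_cast
    linear_combination (2 * (2 * n + 1) : ℂ) * ih - (n.factorial : ℂ) * h

lemma hyp32Term_eq (k z : ℂ) (n : ℕ) :
    hyp32Term (1 / 2) (-k) (-k) 1 2 z n = binomCoeff k n ^ 2 * halfTraceMoment n * z ^ n := by
  have h := ascPochhammer_eval_half n
  have h4 : (4 : ℂ) ^ n ≠ 0 := pow_ne_zero _ (by norm_num)
  have hf : (n.factorial : ℂ) ≠ 0 := by exact_mod_cast n.factorial_ne_zero
  have hn : (n : ℂ) + 1 ≠ 0 := by exact_mod_cast n.succ_ne_zero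
  rw [← eq_div_iff h4] at h
  rw [hyp32Term, h, ascPochhammer_eval_two, ascPochhammer_eval_one, Nat.factorial_succ, binomCoeff,
    halfTraceMoment]
  push_cast
  field_simp

lemma halfTraceMoment_nonneg (n : ℕ) : 0 ≤ halfTraceMoment n := by
  unfold halfTraceMoment; positivity

/-- A telescoping form of the partial sums, which makes their bound by `2` evident. -/
lemma sum_halfTraceMoment (n : ℕ) :
    ∑ i ∈ Finset.range n, halfTraceMoment i = 2 - 2 * (n.centralBinom / 4 ^ n) := by
  induction n with
  | zero => simp
  | succ n ih =>
    have h : ((n : ℝ) + 1) * (n + 1).centralBinom = 2 * (2 * n + 1) * n.centralBinom := by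
      exact_mod_cast Nat.succ_mul_centralBinom_succ n
    have hn : (n : ℝ) + 1 ≠ 0 := by positivity
    have h' : ((n + 1).centralBinom : ℝ) = 2 * (2 * n + 1) * n.centralBinom / (n + 1) := by
      rw [eq_div_iff hn, ← h, mul_comm]
    rw [Finset.sum_range_succ, ih, halfTraceMoment, h', pow_succ]
    field_simp
    ring

lemma summable_halfTraceMoment : Summable halfTraceMoment := by
  refine summable_of_sum_range_le (c := 2) halfTraceMoment_nonneg fun n => ?_
  rw [sum_halfTraceMoment]
  have : (0 : ℝ) ≤ n.centralBinom / 4 ^ n := by positivity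
  linarith

lemma binomCoeff_succ (k : ℂ) (n : ℕ) :
    binomCoeff k (n + 1) = binomCoeff k n * ((n - k) / (n + 1)) := by
  have hf : (n.factorial : ℂ) ≠ 0 := by exact_mod_cast n.factorial_ne_zero
  have hn : (n : ℂ) + 1 ≠ 0 := by exact_mod_cast n.succ_ne_zero
  rw [binomCoeff, binomCoeff, ascPochhammer_succ_eval, Nat.factorial_succ]
  push_cast
  field_simp
  ring

lemma exists_norm_binomCoeff_le {k : ℂ} (hk : -1 < k.re) : ∃ C : ℝ, ∀ n, ‖binomCoeff k n‖ ≤ C := by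
  -- The ratio `|n - k| / (n + 1)` is at most `1` exactly when `|k|² ≤ 2n(1 + Re k) + 1`; beyond
  -- this `N` the moduli are non-increasing.
  obtain ⟨N, hN⟩ := exists_nat_ge (‖k‖ ^ 2 / (2 * (1 + k.re)))
  have hstep : ∀ n, N ≤ n → ‖binomCoeff k (n + 1)‖ ≤ ‖binomCoeff k n‖ := by
    intro n hn
    rw [binomCoeff_succ, norm_mul]
    refine mul_le_of_le_one_right (norm_nonneg _) ?_
    have hn1 : ‖(n : ℂ) + 1‖ = n + 1 := by
      exact_mod_cast Complex.norm_natCast (n + 1)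
    rw [norm_div, hn1]
    refine div_le_one_of_le₀ (abs_le_of_sq_le_sq' ?_ (by positivity)).2 (by positivity)
    have h1 : ‖k‖ ^ 2 ≤ n * (2 * (1 + k.re)) := by
      rw [div_le_iff₀ (by linarith)] at hN
      exact hN.trans (mul_le_mul_of_nonneg_right (by exact_mod_cast hn) (by linarith))
    rw [Complex.sq_norm, Complex.normSq_apply] at h1 ⊢
    simp only [Complex.sub_re, Complex.natCast_re, Complex.sub_im, Complex.natCast_im]
    nlinarith
  refine ⟨∑ i ∈ Finset.range (N + 1), ‖binomCoeff k i‖, fun n => ?_⟩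
  have hle : ∀ n ≤ N, ‖binomCoeff k n‖ ≤ ∑ i ∈ Finset.range (N + 1), ‖binomCoeff k i‖ :=
    fun n hn => Finset.single_le_sum (f := fun i => ‖binomCoeff k i‖)
      (fun i _ => norm_nonneg _) (Finset.mem_range_succ_iff.2 hn)
  induction n with
  | zero => exact hle 0 N.zero_le
  | succ n ih =>
    rcases le_or_gt N n with h | h
    · exact (hstep n h).trans ih
    · exact hle _ h

lemma summable_norm_binomCoeff_sq {k : ℂ} (hk : -1 < k.re) :
    Summable fun n => ‖binomCoeff k n‖ ^ 2 * halfTraceMoment n := by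
  obtain ⟨C, hC⟩ := exists_norm_binomCoeff_le hk
  refine Summable.of_nonneg_of_le (fun n => mul_nonneg (by positivity) (halfTraceMoment_nonneg n))
    (fun n => ?_) (summable_halfTraceMoment.mul_left (C ^ 2))
  exact mul_le_mul_of_nonneg_right (pow_le_pow_left₀ (norm_nonneg _) (hC n) 2)
    (halfTraceMoment_nonneg n)

lemma norm_hyp32Term_le (k : ℂ) {z : ℂ} (hz : ‖z‖ ≤ 1) (n : ℕ) :
    ‖hyp32Term (1 / 2) (-k) (-k) 1 2 z n‖ ≤ ‖binomCoeff k n‖ ^ 2 * halfTraceMoment n := by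
  rw [hyp32Term_eq, norm_mul, norm_mul, norm_pow, norm_pow, Complex.norm_real,
    Real.norm_of_nonneg (halfTraceMoment_nonneg n)]
  exact mul_le_of_le_one_right (mul_nonneg (by positivity) (halfTraceMoment_nonneg n))
    (pow_le_one₀ (norm_nonneg _) hz)

lemma continuousOn_hyp32 {k : ℂ} (hk : -1 < k.re) :
    ContinuousOn (hyp32 (1 / 2) (-k) (-k) 1 2) {z | ‖z‖ ≤ 1} := by
  refine continuousOn_tsum (fun n => ?_) (summable_norm_binomCoeff_sq hk)
    fun n z hz => norm_hyp32Term_le k hz n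
  simp only [hyp32Term_eq]
  fun_prop

/-! ### The formula outside the closed unit disc -/

lemma derivPow_eq (k x : ℂ) (X : U 2) :
    derivPow k x X = ((‖2 * x - X.1.trace‖ : ℝ) : ℂ) ^ (2 * k) := by
  rw [derivPow, norm_deriv_charPoly]

lemma measurable_derivPow (k x : ℂ) : Measurable (derivPow (N := 2) k x) := by
  have h : Continuous fun X : U 2 => ((‖2 * x - X.1.trace‖ : ℝ) : ℂ) := by fun_prop
  simpa only [← derivPow_eq] using h.measurable.pow_const (2 * k)

lemma trace_ne {x : ℂ} (hx : 1 < ‖x‖) (X : U 2) : 2 * x - X.1.trace ≠ 0 := by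
  intro h
  have h1 := norm_trace_le X
  rw [← sub_eq_zero.1 h, norm_mul, Complex.norm_two] at h1
  linarith

lemma integrable_derivPow (k : ℂ) {x : ℂ} (hx : 1 < ‖x‖) :
    Integrable (derivPow (N := 2) k x) (haarU 2) := by
  refine continuous_integrable ?_
  have h : Continuous fun X : U 2 => ((‖2 * x - X.1.trace‖ : ℝ) : ℂ) ^ (2 * k) :=
    Continuous.cpow (by fun_prop) continuous_const fun X =>
      Complex.ofReal_mem_slitPlane.2 (norm_pos_iff.2 (trace_ne hx X))
  simpa only [← derivPow_eq] using h

lemma integral_binomial_term (k x : ℂ) (m n : ℕ) :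
    ∫ X : U 2, (binomCoeff k m * (X.1.trace / (2 * x)) ^ m) *
      (binomCoeff k n * conj (X.1.trace / (2 * x)) ^ n) ∂(haarU 2) =
      if m = n then hyp32Term (1 / 2) (-k) (-k) 1 2 (((‖x‖ : ℝ) : ℂ) ^ (-2 : ℤ)) n else 0 := by
  have h : ∀ X : U 2, (binomCoeff k m * (X.1.trace / (2 * x)) ^ m) *
      (binomCoeff k n * conj (X.1.trace / (2 * x)) ^ n) =
      (binomCoeff k m * binomCoeff k n * (2 * x)⁻¹ ^ m * conj (2 * x)⁻¹ ^ n) *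
      (X.1.trace ^ m * conj (X.1.trace ^ n)) := by
    intro X
    simp only [div_eq_mul_inv, map_mul, map_pow, mul_pow]
    ring
  simp only [h, integral_const_mul, integral_trace_pow_mul_conj]
  split_ifs with hmn
  · subst hmn
    have h1 : (2 * x)⁻¹ ^ m * conj (2 * x)⁻¹ ^ m = (4 ^ m)⁻¹ * (((‖x‖ : ℝ) : ℂ) ^ (-2 : ℤ)) ^ m := by
      rw [← mul_pow, Complex.mul_conj', norm_inv, norm_mul, Complex.norm_two, zpow_neg, ← inv_pow,
        ← mul_pow]
      congr 1
      push_cast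
      rw [inv_pow, mul_pow, mul_inv]
      norm_num
    rw [hyp32Term_eq, mul_assoc _ (_ ^ m) (_ ^ m), h1, halfTraceMoment]
    push_cast
    rw [div_mul_eq_div_div]
    ring
  · simp

lemma hasSum_hyp32Term (k : ℂ) {x : ℂ} (hx : 1 < ‖x‖) :
    HasSum (hyp32Term (1 / 2) (-k) (-k) 1 2 (((‖x‖ : ℝ) : ℂ) ^ (-2 : ℤ)))
      (∫ X : U 2, ((‖1 - X.1.trace / (2 * x)‖ : ℝ) : ℂ) ^ (2 * k) ∂(haarU 2)) := by
  have hx0 : 0 < ‖x‖ := one_pos.trans hx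
  set r : ℝ := ‖x‖⁻¹ with hr
  have hr0 : 0 ≤ r := inv_nonneg.2 hx0.le
  have hr1 : r < 1 := inv_lt_one_of_one_lt₀ hx
  have ht : ∀ X : U 2, ‖X.1.trace / (2 * x)‖ ≤ r := by
    intro X
    rw [norm_div, norm_mul, Complex.norm_two, hr, div_le_iff₀ (by positivity)]
    have := norm_trace_le X
    field_simp
    exact this
  have hsum : Summable fun n => ‖binomCoeff k n‖ * r ^ n := by
    have := (hasSum_one_sub_cpow k (t := r) (by simpa [abs_of_nonneg hr0] using hr1)).summable.norm
    simpa [abs_of_nonneg hr0] using this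
  set F : ℕ × ℕ → U 2 → ℂ := fun p X => (binomCoeff k p.1 * (X.1.trace / (2 * x)) ^ p.1) *
      (binomCoeff k p.2 * conj (X.1.trace / (2 * x)) ^ p.2) with hF
  have hbound : ∀ p X, ‖F p X‖ ≤ (‖binomCoeff k p.1‖ * r ^ p.1) * (‖binomCoeff k p.2‖ * r ^ p.2) := by
    intro p X
    simp only [hF, norm_mul, norm_pow, RCLike.norm_conj]
    gcongr <;> exact ht X
  have hsum2 := hsum.mul_of_nonneg hsum (fun n => by positivity) (fun n => by positivity)
  have hFint : ∀ p, Integrable (F p) (haarU 2) := fun p => continuous_integrable (by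
    simp only [hF, div_eq_mul_inv]; fun_prop)
  have key := hasSum_integral_of_summable_integral_norm hFint
    (Summable.of_nonneg_of_le (fun p => integral_nonneg fun X => norm_nonneg _) (fun p => by
      have := integral_mono (hFint p).norm (integrable_const _) (hbound p)
      simpa using this) hsum2)
  have htsum : ∀ X : U 2, ∑' p, F p X = ((‖1 - X.1.trace / (2 * x)‖ : ℝ) : ℂ) ^ (2 * k) := by
    intro X
    have ht1 := (ht X).trans_lt hr1
    have hs1 := hasSum_one_sub_cpow k ht1
    have hs2 := hasSum_one_sub_cpow k (t := conj (X.1.trace / (2 * x))) (by simpa using ht1)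
    rw [← one_sub_cpow_mul_conj k ht1]
    exact (hs1.mul hs2 (Summable.of_norm_bounded hsum2 fun p => hbound p X)).tsum_eq
  simp only [htsum] at key
  simp only [hF, integral_binomial_term] at key
  -- Only the diagonal of the double series survives integration, so the sum over pairs collapses to
  -- a sum over `n`.
  have hinj : Function.Injective fun n : ℕ => (n, n) := fun a b h => (Prod.ext_iff.1 h).1
  rw [← hinj.hasSum_iff] at key
  · simpa only [Function.comp_def, if_true] using key
  · rintro ⟨a, b⟩ hab
    exact if_neg fun h => hab ⟨a, Prod.ext rfl h⟩

lemma integral_derivPow (k : ℂ) {x : ℂ} (hx : 1 < ‖x‖) :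
    ∫ X : U 2, derivPow k x X ∂(haarU 2) = (2 : ℂ) ^ (2 * k) * ((‖x‖ : ℝ) : ℂ) ^ (2 * k) *
      hyp32 (1 / 2) (-k) (-k) 1 2 (((‖x‖ : ℝ) : ℂ) ^ (-2 : ℤ)) := by
  rw [hyp32, (hasSum_hyp32Term k hx).tsum_eq, ← integral_const_mul]
  congr 1
  funext X
  have hx0 : x ≠ 0 := norm_pos_iff.1 (one_pos.trans hx)
  have h : 2 * x - X.1.trace = 2 * x * (1 - X.1.trace / (2 * x)) := by field_simp
  rw [derivPow_eq, h, norm_mul, norm_mul, Complex.norm_two, Complex.ofReal_mul,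
    Complex.mul_cpow_ofReal_nonneg (by positivity) (norm_nonneg _), Complex.ofReal_mul,
    Complex.mul_cpow_ofReal_nonneg zero_le_two (norm_nonneg _), Complex.ofReal_ofNat]

/-! ### Integrability, continuity and the formula up to the unit circle -/

/-- The phase of `x` is absorbed by a scalar matrix, so by Haar invariance only `|x|` matters. -/
lemma derivPow_eq_mul_left (k : ℂ) (x : ℂ) :
    ∃ g : U 2, ∀ X, derivPow k x X = derivPow k (‖x‖ : ℝ) (g * X) := by
  obtain ⟨u, hu, hxu⟩ : ∃ u : ℂ, ‖u‖ = 1 ∧ ((‖x‖ : ℝ) : ℂ) = u * x := by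
    rcases eq_or_ne x 0 with rfl | hx
    · exact ⟨1, by simp, by simp⟩
    · have : ((‖x‖ : ℝ) : ℂ) ≠ 0 := by simpa using hx
      refine ⟨‖x‖ / x, ?_, by field_simp⟩
      simp [hx]
  refine ⟨diagU u u hu hu, fun X => ?_⟩
  have h : 2 * ((‖x‖ : ℝ) : ℂ) - (diagU u u hu hu * X).1.trace = u * (2 * x - X.1.trace) := by
    rw [Matrix.trace_fin_two, Matrix.trace_fin_two, diagU_mul_apply_zero, diagU_mul_apply_one, hxu]
    ring
  rw [derivPow_eq, derivPow_eq, h, norm_mul, hu, one_mul]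

lemma integral_derivPow_eq_norm (k x : ℂ) :
    ∫ X : U 2, derivPow k x X ∂(haarU 2) = ∫ X : U 2, derivPow k (‖x‖ : ℝ) X ∂(haarU 2) := by
  obtain ⟨g, hg⟩ := derivPow_eq_mul_left k x
  simp only [hg, integral_mul_left_eq_self]

lemma integrable_derivPow_of_norm {k x : ℂ}
    (h : Integrable (derivPow (N := 2) k (‖x‖ : ℝ)) (haarU 2)) :
    Integrable (derivPow (N := 2) k x) (haarU 2) := by
  obtain ⟨g, hg⟩ := derivPow_eq_mul_left k x
  exact (h.comp_mul_left g).congr (.of_forall fun X => (hg X).symm)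

lemma norm_derivPow (k x : ℂ) (X : U 2) (h : 2 * x - X.1.trace ≠ 0) :
    ‖derivPow k x X‖ = ‖2 * x - X.1.trace‖ ^ (2 * k.re) := by
  rw [derivPow_eq, Complex.norm_cpow_eq_rpow_re_of_pos (norm_pos_iff.2 h)]
  simp

/-- The point is that the bound is independent of `ρ`: for `κ ≤ 0` the prefactors `2^{2κ}` and
`ρ^{2κ}` are at most `1`, and the series is dominated termwise. -/
lemma integral_rpow_le {κ : ℝ} (hκ : κ ≤ 0) (hκ1 : -1 < κ) {ρ : ℝ} (hρ : 1 < ρ) :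
    ∫ X : U 2, ‖2 * (ρ : ℂ) - X.1.trace‖ ^ (2 * κ) ∂(haarU 2) ≤
      ∑' n, ‖binomCoeff κ n‖ ^ 2 * halfTraceMoment n := by
  have hρ0 : 0 < ρ := one_pos.trans hρ
  have hn : ‖(ρ : ℂ)‖ = ρ := by simp [abs_of_pos hρ0]
  have h := integral_derivPow (κ : ℂ) (x := (ρ : ℂ)) (by rwa [hn])
  have h1 : ∀ X : U 2, derivPow (κ : ℂ) ρ X =
      ((‖2 * (ρ : ℂ) - X.1.trace‖ ^ (2 * κ) : ℝ) : ℂ) := by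
    intro X
    rw [derivPow_eq, Complex.ofReal_cpow (norm_nonneg _)]
    push_cast
    rfl
  simp only [h1, integral_complex_ofReal, hn] at h
  have h2 := congrArg norm h
  rw [Complex.norm_real, Real.norm_of_nonneg (integral_nonneg fun X => by positivity)] at h2
  rw [h2, norm_mul, norm_mul]
  have hz : ‖((ρ : ℂ) ^ (-2 : ℤ))‖ ≤ 1 := by
    rw [norm_zpow, hn, zpow_neg]
    exact inv_le_one_of_one_le₀ (one_le_pow₀ hρ.le)
  have hexp : ((2 * κ : ℝ) : ℂ) = 2 * κ := by push_cast; rfl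
  have ha : ‖(2 : ℂ) ^ (2 * (κ : ℂ))‖ ≤ 1 := by
    rw [← hexp, ← Complex.ofReal_ofNat 2, Complex.norm_cpow_eq_rpow_re_of_pos two_pos]
    exact Real.rpow_le_one_of_one_le_of_nonpos one_le_two (by rw [Complex.ofReal_re]; linarith)
  have hb : ‖(ρ : ℂ) ^ (2 * (κ : ℂ))‖ ≤ 1 := by
    rw [← hexp, Complex.norm_cpow_eq_rpow_re_of_pos hρ0]
    exact Real.rpow_le_one_of_one_le_of_nonpos hρ.le (by rw [Complex.ofReal_re]; linarith)
  have hc : ‖hyp32 (1 / 2) (-(κ : ℂ)) (-(κ : ℂ)) 1 2 ((ρ : ℂ) ^ (-2 : ℤ))‖ ≤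
      ∑' n, ‖binomCoeff κ n‖ ^ 2 * halfTraceMoment n :=
    tsum_of_norm_bounded (summable_norm_binomCoeff_sq (by simpa using hκ1)).hasSum
      fun n => norm_hyp32Term_le _ hz n
  calc _ ≤ 1 * 1 * ∑' n, ‖binomCoeff κ n‖ ^ 2 * halfTraceMoment n := by gcongr
    _ = _ := by ring

/-- Fatou's lemma along `ρ ↓ 1`, with the bound uniform in `ρ`. -/
lemma lintegral_rpow_lt_top {κ : ℝ} (hκ : κ ≤ 0) (hκ1 : -1 < κ) :
    ∫⁻ X : U 2, ‖2 - X.1.trace‖ₑ ^ (2 * κ) ∂(haarU 2) < ⊤ := by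
  set ρ : ℕ → ℝ := fun n => 1 + 1 / ((n : ℝ) + 1) with hρ
  have hρ1 : ∀ n, 1 < ρ n := fun n => by
    have : (0 : ℝ) < 1 / ((n : ℝ) + 1) := by positivity
    simp only [hρ]; linarith
  have hρt : Tendsto ρ atTop (𝓝 1) := by
    simpa [hρ] using tendsto_one_div_add_atTop_nhds_zero_nat.const_add (1 : ℝ)
  have hmeas : ∀ n, Measurable fun X : U 2 => ‖2 * (ρ n : ℂ) - X.1.trace‖ₑ ^ (2 * κ) := fun n =>
    (ENNReal.continuous_rpow_const.comp
      (Continuous.enorm (f := fun X : U 2 => 2 * (ρ n : ℂ) - X.1.trace) (by fun_prop))).measurable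
  have hlim : ∀ X : U 2, liminf (fun n => ‖2 * (ρ n : ℂ) - X.1.trace‖ₑ ^ (2 * κ)) atTop =
      ‖2 - X.1.trace‖ₑ ^ (2 * κ) := by
    intro X
    refine Tendsto.liminf_eq ?_
    -- In `[0, ∞]` a negative power is continuous even at base `0`, so matrices with `tr X = 2` need
    -- no separate treatment.
    have hc : Continuous fun r : ℝ => ‖2 * (r : ℂ) - X.1.trace‖ₑ ^ (2 * κ) :=
      ENNReal.continuous_rpow_const.comp (Continuous.enorm (by fun_prop))
    simpa [Function.comp_def] using (hc.tendsto 1).comp hρt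
  have hle : ∀ n, ∫⁻ X : U 2, ‖2 * (ρ n : ℂ) - X.1.trace‖ₑ ^ (2 * κ) ∂(haarU 2) ≤
      ENNReal.ofReal (∑' n, ‖binomCoeff κ n‖ ^ 2 * halfTraceMoment n) := by
    intro n
    have hn : 1 < ‖(ρ n : ℂ)‖ := by simpa [abs_of_pos (one_pos.trans (hρ1 n))] using hρ1 n
    refine le_trans (le_of_eq ?_) (ENNReal.ofReal_le_ofReal (integral_rpow_le hκ hκ1 (hρ1 n)))
    rw [ofReal_integral_eq_lintegral_ofReal]
    · congr 1
      funext X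
      rw [← ofReal_norm, ENNReal.ofReal_rpow_of_pos (norm_pos_iff.2 (trace_ne hn X))]
    · refine continuous_integrable (Continuous.rpow_const (by fun_prop) fun X => Or.inl ?_)
      exact norm_ne_zero_iff.2 (trace_ne hn X)
    · exact .of_forall fun X => by positivity
  calc _ = ∫⁻ X : U 2, liminf (fun n => ‖2 * (ρ n : ℂ) - X.1.trace‖ₑ ^ (2 * κ)) atTop ∂(haarU 2) := by
        simp only [hlim]
    _ ≤ _ := lintegral_liminf_le hmeas
    _ ≤ _ := liminf_le_of_le (by isBoundedDefault) fun b hb => by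
        obtain ⟨n, hn⟩ := hb.exists
        exact hn.trans (hle n)
    _ < ⊤ := ENNReal.ofReal_lt_top

/-- A negative power of `|2 - tr X|` has finite integral yet is infinite on the zero set, which is
therefore null. -/
lemma ae_two_sub_trace_ne_zero : ∀ᵐ X : U 2 ∂(haarU 2), 2 - X.1.trace ≠ 0 := by
  have h := lintegral_rpow_lt_top (κ := -(1 / 2)) (by norm_num) (by norm_num)
  have hm : Measurable fun X : U 2 => ‖2 - X.1.trace‖ₑ ^ (2 * (-(1 / 2) : ℝ)) :=
    (ENNReal.continuous_rpow_const.comp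
      (Continuous.enorm (f := fun X : U 2 => 2 - X.1.trace) (by fun_prop))).measurable
  filter_upwards [ae_lt_top hm h.ne] with X hX h0
  rw [h0, enorm_zero, ENNReal.zero_rpow_of_neg (by norm_num)] at hX
  exact hX.ne rfl

lemma integrable_rpow {κ : ℝ} (hκ : -1 < κ) :
    Integrable (fun X : U 2 => ‖2 - X.1.trace‖ ^ (2 * κ)) (haarU 2) := by
  rcases le_total 0 κ with h | h
  · exact continuous_integrable
      (Continuous.rpow_const (by fun_prop) fun X => Or.inr (by positivity))
  · have hc : Continuous fun X : U 2 => ‖2 - X.1.trace‖ := by fun_prop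
    refine ⟨(hc.measurable.pow_const _).aestronglyMeasurable, ?_⟩
    refine lt_of_eq_of_lt (lintegral_congr_ae ?_) (lintegral_rpow_lt_top h hκ)
    filter_upwards [ae_two_sub_trace_ne_zero] with X hX
    rw [← ofReal_norm, ← ofReal_norm,
      ENNReal.ofReal_rpow_of_pos (norm_pos_iff.2 hX), Real.norm_of_nonneg (by positivity)]

/-- As `|tr X| ≤ 2`, moving from `2ρ` to `2` costs `2ρ - 2 ≤ |2ρ - tr X|`. This controls negative
powers near the circle by those at `x = 1`. -/
lemma norm_two_sub_trace_le (X : U 2) {ρ : ℝ} (hρ : 1 ≤ ρ) :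
    ‖2 - X.1.trace‖ ≤ 2 * ‖2 * (ρ : ℂ) - X.1.trace‖ := by
  have h1 : 2 * ρ - 2 ≤ ‖2 * (ρ : ℂ) - X.1.trace‖ := by
    have := norm_sub_norm_le (2 * (ρ : ℂ)) X.1.trace
    rw [norm_mul, Complex.norm_two, Complex.norm_real, Real.norm_of_nonneg (by linarith)] at this
    linarith [norm_trace_le X]
  have h2 : 2 - X.1.trace = (2 * (ρ : ℂ) - X.1.trace) - ((2 * ρ - 2 : ℝ) : ℂ) := by
    push_cast; ring
  calc ‖2 - X.1.trace‖ ≤ ‖2 * (ρ : ℂ) - X.1.trace‖ + ‖((2 * ρ - 2 : ℝ) : ℂ)‖ := by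
        rw [h2]; exact norm_sub_le _ _
    _ ≤ _ := by
        rw [Complex.norm_real, Real.norm_of_nonneg (by linarith)]; linarith

lemma norm_derivPow_le (k : ℂ) (X : U 2) (hX : 2 - X.1.trace ≠ 0) {ρ R : ℝ} (hρ : 1 ≤ ρ)
    (hR : ρ ≤ R) :
    ‖derivPow k ρ X‖ ≤ (2 * R + 2) ^ (2 * k.re) +
      2⁻¹ ^ (2 * k.re) * ‖2 - X.1.trace‖ ^ (2 * k.re) := by
  have h0 := norm_pos_iff.2 hX
  have h1 := norm_two_sub_trace_le X hρ
  have h2 : 0 < ‖2 * (ρ : ℂ) - X.1.trace‖ := by linarith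
  -- The first summand of the bound serves `Re k ≥ 0`, the second `Re k ≤ 0`.
  rw [norm_derivPow k ρ X (norm_pos_iff.1 h2), ← Real.mul_rpow (by norm_num) h0.le]
  rcases le_total 0 k.re with h | h
  · refine le_add_of_le_of_nonneg (Real.rpow_le_rpow h2.le ?_ (by positivity)) (by positivity)
    refine (norm_sub_le _ _).trans ?_
    rw [norm_mul, Complex.norm_two, Complex.norm_real, Real.norm_of_nonneg (by linarith)]
    linarith [norm_trace_le X]
  · refine le_add_of_nonneg_of_le (Real.rpow_nonneg (by linarith) _)
      (Real.rpow_le_rpow_of_nonpos (by positivity) ?_ (by linarith))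
    linarith

lemma integrable_bound {k : ℂ} (hk : -1 < k.re) (R : ℝ) :
    Integrable (fun X : U 2 => (2 * R + 2) ^ (2 * k.re) +
      2⁻¹ ^ (2 * k.re) * ‖2 - X.1.trace‖ ^ (2 * k.re)) (haarU 2) :=
  (integrable_const _).add ((integrable_rpow hk).const_mul _)

lemma integrable_derivPow_of_neg_one_lt {k x : ℂ} (hk : -1 < k.re) (hx : 1 ≤ ‖x‖) :
    Integrable (derivPow (N := 2) k x) (haarU 2) := by
  refine integrable_derivPow_of_norm ((integrable_bound hk ‖x‖).mono'
    (measurable_derivPow _ _).aestronglyMeasurable ?_)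
  filter_upwards [ae_two_sub_trace_ne_zero] with X hX
  exact norm_derivPow_le k X hX hx le_rfl

lemma continuousOn_integral_derivPow_real {k : ℂ} (hk : -1 < k.re) :
    ContinuousOn (fun ρ : ℝ => ∫ X : U 2, derivPow k ρ X ∂(haarU 2)) (Set.Ici 1) := by
  intro ρ₀ hρ₀
  refine continuousWithinAt_of_dominated
    (.of_forall fun ρ => (measurable_derivPow _ _).aestronglyMeasurable) ?_
    (integrable_bound hk (ρ₀ + 1)) ?_
  · have h : ∀ᶠ ρ in 𝓝[Set.Ici 1] ρ₀, ρ ≤ ρ₀ + 1 :=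
      mem_nhdsWithin_of_mem_nhds (Iic_mem_nhds (by linarith))
    filter_upwards [self_mem_nhdsWithin, h] with ρ hρ hρ'
    filter_upwards [ae_two_sub_trace_ne_zero] with X hX
    exact norm_derivPow_le k X hX hρ hρ'
  · filter_upwards [ae_two_sub_trace_ne_zero] with X hX
    simp only [derivPow_eq]
    have h1 := norm_two_sub_trace_le X hρ₀
    have h0 := norm_pos_iff.2 hX
    refine ContinuousAt.continuousWithinAt (ContinuousAt.cpow (by fun_prop) continuousAt_const
      (Complex.ofReal_mem_slitPlane.2 ?_))
    linarith

lemma continuousOn_integral_derivPow {k : ℂ} (hk : -1 < k.re) :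
    ContinuousOn (fun x : ℂ => ∫ X : U 2, derivPow k x X ∂(haarU 2)) {x : ℂ | 1 ≤ ‖x‖} := by
  have h := (continuousOn_integral_derivPow_real hk).comp (s := {x : ℂ | 1 ≤ ‖x‖})
    continuous_norm.continuousOn fun x hx => hx
  exact h.congr fun x _ => integral_derivPow_eq_norm k x

lemma summable_hyp32Term {k : ℂ} (hk : -1 < k.re) {z : ℂ} (hz : ‖z‖ ≤ 1) :
    Summable (hyp32Term (1 / 2) (-k) (-k) 1 2 z) :=
  Summable.of_norm_bounded (summable_norm_binomCoeff_sq hk) (norm_hyp32Term_le k hz)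

lemma integral_derivPow_of_norm_eq_one {k x : ℂ} (hk : -1 < k.re) (hx : ‖x‖ = 1) :
    ∫ X : U 2, derivPow k x X ∂(haarU 2) = (2 : ℂ) ^ (2 * k) * ((‖x‖ : ℝ) : ℂ) ^ (2 * k) *
      hyp32 (1 / 2) (-k) (-k) 1 2 (((‖x‖ : ℝ) : ℂ) ^ (-2 : ℤ)) := by
  rw [integral_derivPow_eq_norm, hx]
  have hz : ContinuousOn (fun ρ : ℝ => (ρ : ℂ) ^ (-2 : ℤ)) (Set.Ici 1) := fun ρ hρ =>
    (Complex.continuous_ofReal.continuousAt.zpow₀ _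
      (Or.inl (by exact_mod_cast (one_pos.trans_le hρ).ne'))).continuousWithinAt
  have hmaps : Set.MapsTo (fun ρ : ℝ => (ρ : ℂ) ^ (-2 : ℤ)) (Set.Ici 1) {z : ℂ | ‖z‖ ≤ 1} := by
    intro ρ hρ
    have h1 : (1 : ℝ) ≤ |ρ| := le_trans hρ (le_abs_self ρ)
    simpa using inv_le_one_of_one_le₀ (one_le_pow₀ h1 (n := 2))
  have hpow : ContinuousOn (fun ρ : ℝ => (ρ : ℂ) ^ (2 * k)) (Set.Ici 1) := fun ρ hρ =>
    (ContinuousAt.cpow Complex.continuous_ofReal.continuousAt continuousAt_const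
      (Complex.ofReal_mem_slitPlane.2 (one_pos.trans_le hρ))).continuousWithinAt
  have hR := (continuousOn_const (c := (2 : ℂ) ^ (2 * k))).mul hpow |>.mul
    ((continuousOn_hyp32 hk).comp hz hmaps)
  have hL := continuousOn_integral_derivPow_real hk
  have hmem : (1 : ℝ) ∈ Set.Ici (1 : ℝ) := Set.self_mem_Ici
  -- Both sides are continuous on `[1, ∞)` and agree for `ρ > 1`, so their limits at `1` coincide.
  have hL1 := (hL 1 hmem).mono_left (nhdsWithin_mono 1 Set.Ioi_subset_Ici_self)
  have hR1 := (hR 1 hmem).mono_left (nhdsWithin_mono 1 Set.Ioi_subset_Ici_self)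
  refine tendsto_nhds_unique_of_eventuallyEq hL1 hR1 ?_
  filter_upwards [self_mem_nhdsWithin] with ρ hρ
  have hn : ‖(ρ : ℂ)‖ = ρ := by
    simp [abs_of_pos (one_pos.trans (Set.mem_Ioi.1 hρ))]
  have h := integral_derivPow k (x := (ρ : ℂ)) (by rwa [hn])
  rwa [hn] at h

end UnitaryMoments

theorem theorem4p2 (k : ℂ) :
    (∀ x : ℂ, (1 < ‖x‖ ∨ (‖x‖ = 1 ∧ -1 < k.re)) →
      Integrable (UnitaryMoments.derivPow k x) (UnitaryMoments.haarU 2) ∧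
      Summable (UnitaryMoments.hyp32Term (1 / 2) (-k) (-k) 1 2 (((‖x‖ : ℝ) : ℂ) ^ (-2 : ℤ))) ∧
      ∫ X, UnitaryMoments.derivPow k x X ∂(UnitaryMoments.haarU 2) =
        (2 : ℂ) ^ (2 * k) * ((‖x‖ : ℝ) : ℂ) ^ (2 * k) *
          UnitaryMoments.hyp32 (1 / 2) (-k) (-k) 1 2 (((‖x‖ : ℝ) : ℂ) ^ (-2 : ℤ))) ∧
    (-1 < k.re →
      ContinuousOn
        (fun x : ℂ => ∫ X, UnitaryMoments.derivPow k x X ∂(UnitaryMoments.haarU 2))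
        {x : ℂ | 1 ≤ ‖x‖}) := by
  refine ⟨fun x hx => ?_, UnitaryMoments.continuousOn_integral_derivPow⟩
  rcases hx with hx | ⟨hx, hk⟩
  · exact ⟨UnitaryMoments.integrable_derivPow k hx,
      (UnitaryMoments.hasSum_hyp32Term k hx).summable, UnitaryMoments.integral_derivPow k hx⟩
  · exact ⟨UnitaryMoments.integrable_derivPow_of_neg_one_lt hk hx.ge,
      UnitaryMoments.summable_hyp32Term hk (by simp [hx]),
      UnitaryMoments.integral_derivPow_of_norm_eq_one hk hx⟩
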